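/- Let $K$ be an algebraically closed field and $R=K[x_1,\dots,x_n]$ with a term order $\prec$. For ideals $I,J$ of $R$ the join is $$I\ast J=\bigl(I(\mathbf y)+J(\mathbf z)+\langle x_i-y_i-z_i : 1\le i\le n\rangle\bigr)\cap K[\mathbf x],$$ and for $r\ge 1$ the $r$-th secant ideal $I^{\{r\}}=I\ast\cdots\ast I$ is the join of $r$ copies of $I$. The $s$-th symbolic power of an ideal $I$ is $I^{(s)}=(S^{-1}I^s)\cap R$, where $S$ is the complement of the union of the minimal primes of $I$. A subset $\mathcal G\subseteq I$ is a Gröbner basis of $I$ if the leading terms of its elements generate $\mathrm{in}_\prec(I)$. The term order $\prec$ is $r$-delightful for $I$ if $\mathrm{in}_\prec(I^{\{r\}})=\mathrm{in}_\prec(I)^{\{r\}}$, and delightful if this holds for all $r\ge1$. For $r,s\ge 1$, we say that $I$ satisfies the recurrence at $(r,s)$ if $$\bigl(I^{\{r\}}\bigr)^{(s)}=I^{\{r+s-1\}}+\sum_{i=1}^{s-1}\bigl(I^{\{r\}}\bigr)^{(i)}\bigl(I^{\{r\}}\bigr)^{(s-i)},$$ and $I$ is differentially perfect if it satisfies the recurrence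 at all $r,s\ge1$. **Theorem.** Let $I\subseteq R$ be a homogeneous ideal such that $I$ and $\mathrm{in}_\prec(I)$ are radical. (1) Let $t,u$ be natural numbers such that $\prec$ is $r$-delightful for $I$ for all $1\le r\le t$, and such that $\mathrm{in}_\prec(I)$ satisfies the recurrence at $(r,s)$ for all $1\le r\le t$ and $1\le s\le u$. For $1\le r\le t$ let $\mathcal G_r$ be a Gröbner basis of $I^{\{r\}}$ with respect to $\prec$. Then for all $1\le r\le t$ and $1\le s\le\min(u,t-r+1)$ the set $$\mathcal G_{r,s}=\Bigl\{\prod_{i=1}^{l} g_i \;:\; l\ge 0,\ r_i\ge r,\ g_i\in\mathcal G_{r_i},\ \sum_{i=1}^{l}(r_i-r+1)=s\Bigr\}$$ is a Gröbner basis of $(I^{\{r\}})^{(s)}$ with respect to $\prec$, and it is finite if $\mathcal G_1,\dots,\mathcal G_t$ are finite. (The conditions force $r_i\le t$.) In particular, $I$ satisfies the recurrence at $(r,s)$ for all $1\le r\le t$ and $1\le s\le\min(u,t-r+1)$. (2) If $\prec$ is delightful for $I$ and $\mathrm{in}_\prec(I)$ is differentially perfect, then $I$ is differentially perfect. -/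

import Mathlib

open MvPolynomial

/-- The `r`-th symbolic power `I^(r) = (S⁻¹ I^r) ∩ R`, where `S` is the complement of the union of
the minimal primes of `I`. -/
def symbolicPower {R : Type*} [CommRing R] (I : Ideal R) (r : ℕ) : Ideal R where
  carrier := {f | ∃ a : R, (∀ P ∈ I.minimalPrimes, a ∉ P) ∧ a * f ∈ I ^ r}
  zero_mem' := ⟨1, fun _ hP h => hP.1.1.ne_top ((Ideal.eq_top_iff_one _).2 h), by simp⟩
  add_mem' := by
    rintro f g ⟨a, ha, haf⟩ ⟨b, hb, hbg⟩
    refine ⟨a * b, fun P hP h => (hP.1.1.mem_or_mem h).elim (ha P hP) (hb P hP), ?_⟩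
    have h : a * b * (f + g) = b * (a * f) + a * (b * g) := by ring
    rw [h]
    exact Ideal.add_mem _ (Ideal.mul_mem_left _ _ haf) (Ideal.mul_mem_left _ _ hbg)
  smul_mem' := by
    rintro c f ⟨a, ha, haf⟩
    refine ⟨a, ha, ?_⟩
    have h : a * (c • f) = c * (a * f) := by rw [smul_eq_mul]; ring
    rw [h]
    exact Ideal.mul_mem_left _ _ haf

/-- The join `I * J = (I(y) + J(z) + ⟨x_i - y_i - z_i⟩) ∩ K[x]`. The polynomial ring `K[x, y, z]`
has variables indexed by `σ ⊕ (σ ⊕ σ)`: the three summands index the `x`, the `y` and the `z`. -/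
noncomputable def joinIdeal {σ K : Type*} [Field K] (I J : Ideal (MvPolynomial σ K)) :
    Ideal (MvPolynomial σ K) :=
  Ideal.comap (rename (R := K) (Sum.inl : σ → σ ⊕ (σ ⊕ σ)))
    (Ideal.map (rename (R := K) (fun i : σ => (Sum.inr (Sum.inl i) : σ ⊕ (σ ⊕ σ)))) I ⊔
      Ideal.map (rename (R := K) (fun i : σ => (Sum.inr (Sum.inr i) : σ ⊕ (σ ⊕ σ)))) J ⊔
      Ideal.span (Set.range fun i : σ =>
        (X (Sum.inl i) - X (Sum.inr (Sum.inl i)) - X (Sum.inr (Sum.inr i)) :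
          MvPolynomial (σ ⊕ (σ ⊕ σ)) K)))

/-- The `r`-th secant ideal of `I`, the join of `r` copies of `I`, for `r ≥ 1`. (For `r = 0` we put
the ideal of the variables, the neutral element of the join; this value is never used.) -/
noncomputable def secantIdeal {σ K : Type*} [Field K] (I : Ideal (MvPolynomial σ K)) :
    ℕ → Ideal (MvPolynomial σ K)
  | 0 => Ideal.span (Set.range X)
  | 1 => I
  | r + 2 => joinIdeal (secantIdeal I (r + 1)) I

/-- The initial ideal: the ideal generated by the leading terms of the elements of `I`. -/
noncomputable def initialIdeal {σ K : Type*} [Field K] (m : MonomialOrder σ)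
    (I : Ideal (MvPolynomial σ K)) : Ideal (MvPolynomial σ K) :=
  Ideal.span (m.leadingTerm '' (I : Set (MvPolynomial σ K)))

/-- `G` is a Gröbner basis of `I` (finite or not). -/
def IsGroebnerBasis {σ K : Type*} [Field K] (m : MonomialOrder σ)
    (G : Set (MvPolynomial σ K)) (I : Ideal (MvPolynomial σ K)) : Prop :=
  G ⊆ I ∧ Ideal.span (m.leadingTerm '' G) = initialIdeal m I

/-- The term order `m` is `r`-delightful for `I`. -/
def IsDelightfulAt {σ K : Type*} [Field K] (m : MonomialOrder σ)
    (I : Ideal (MvPolynomial σ K)) (r : ℕ) : Prop :=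
  initialIdeal m (secantIdeal I r) = secantIdeal (initialIdeal m I) r

/-- The term order `m` is delightful for `I`. -/
def IsDelightful {σ K : Type*} [Field K] (m : MonomialOrder σ)
    (I : Ideal (MvPolynomial σ K)) : Prop :=
  ∀ r : ℕ, 1 ≤ r → IsDelightfulAt m I r

/-- The recurrence
`(I^{r})^(s) = I^{r+s-1} + ∑_{i=1}^{s-1} (I^{r})^(i) (I^{r})^(s-i)`, used for `r, s ≥ 1`. -/
def SatisfiesRecurrence {σ K : Type*} [Field K] (I : Ideal (MvPolynomial σ K)) (r s : ℕ) : Prop :=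
  symbolicPower (secantIdeal I r) s =
    secantIdeal I (r + s - 1) +
      ∑ i ∈ Finset.Ico 1 s,
        symbolicPower (secantIdeal I r) i * symbolicPower (secantIdeal I r) (s - i)

/-- `I` is `r`-differentially perfect. -/
def IsDiffPerfectAt {σ K : Type*} [Field K] (I : Ideal (MvPolynomial σ K)) (r : ℕ) : Prop :=
  ∀ s : ℕ, 1 ≤ s → SatisfiesRecurrence I r s

/-- `I` is differentially perfect. -/
def IsDiffPerfect {σ K : Type*} [Field K] (I : Ideal (MvPolynomial σ K)) : Prop :=
  ∀ r : ℕ, 1 ≤ r → IsDiffPerfectAt I r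

/-- The products `g₁ ⋯ g_l` (any `l`) with `g_i ∈ G (ρ i)`, `ρ i ≥ r` and
`∑ i, (ρ i - r + 1) = s`. -/
def groebnerProducts {σ K : Type*} [Field K] (G : ℕ → Set (MvPolynomial σ K)) (r s : ℕ) :
    Set (MvPolynomial σ K) :=
  {p | ∃ (l : ℕ) (ρ : Fin l → ℕ) (g : Fin l → MvPolynomial σ K),
    (∀ i, r ≤ ρ i ∧ g i ∈ G (ρ i)) ∧ ∑ i, (ρ i - r + 1) = s ∧ p = ∏ i, g i}

/-! The key inclusion is in(J^(s)) ⊆ in(J)^(s) for J and in(J) radical. Over a perfect field, the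
symbolic power of a radical ideal J consists of the polynomials whose Hasse derivatives of order
less than s lie in J (`symbolicPower_eq_differentialPower`). A Hasse derivative shifts exponents by
a constant, so it either kills the leading term of f or sends it to the leading term of the
derivative of f (`leadingTerm_mem_differentialPower`).

Take J = I^{r}. Delightfulness turns in(J) into in(I)^{r}, and the recurrence for in(I) breaks the
symbolic power of the latter into products of ideals in(I)^{ρ} = in(I^{ρ}), each generated by the
leading terms of G_ρ. Hence the leading terms of the products of the g_i generate an ideal
containing in((I^{r})^(s)).

That these products lie in (I^{r})^(s) reduces to I^{r+s-1} ⊆ (I^{r})^(s)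
(`secantIdeal_le_symbolicPower`), where only s ≥ 2 needs an argument. Secant ideals are vanishing
ideals of sumsets of the cone V = V(I). If V is nonempty it spans affine space: otherwise I contains
a linear form, so in(I) contains a variable, which then lies in in(I)^{2} ⊆ in(I)^(2), and its
constant derivative forbids this. Since V contains a basis, vanishing on the (r+s-1)-fold sumset
forces vanishing to order s along the r-fold one.

The two sides of the recurrence for I are then nested ideals with the same initial ideal, hence
equal. -/

/-- The Taylor expansion `f(X + Z)`, a polynomial in `Z` with coefficients in `K[X]`. -/
noncomputable def taylorExpand (σ K : Type*) [CommRing K] :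
    MvPolynomial σ K →ₐ[K] MvPolynomial σ (MvPolynomial σ K) :=
  aeval fun i => C (X i) + X i

/-- The polynomials all of whose Hasse derivatives of order less than `s` lie in `J`. -/
noncomputable def differentialPower {σ K : Type*} [CommRing K] (J : Ideal (MvPolynomial σ K))
    (s : ℕ) : Ideal (MvPolynomial σ K) :=
  Ideal.comap ((map (Ideal.Quotient.mk J)).comp (taylorExpand σ K).toRingHom)
    (idealOfVars σ (MvPolynomial σ K ⧸ J) ^ s)

/-! ### Hasse derivatives and symbolic powers -/

section Taylor

variable {σ K : Type*}

theorem mem_differentialPower [CommRing K] {J : Ideal (MvPolynomial σ K)} {s : ℕ}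
    {f : MvPolynomial σ K} :
    f ∈ differentialPower J s ↔
      ∀ α : σ →₀ ℕ, α.degree < s → coeff α (taylorExpand σ K f) ∈ J := by
  rw [differentialPower, Ideal.mem_comap, mem_pow_idealOfVars_iff']
  simp [coeff_map, Ideal.Quotient.eq_zero_iff_mem]

theorem differentialPower_mono [CommRing K] {J J' : Ideal (MvPolynomial σ K)} (h : J ≤ J')
    (s : ℕ) : differentialPower J s ≤ differentialPower J' s := fun _ hf =>
  mem_differentialPower.2 fun α hα => h (mem_differentialPower.1 hf α hα)

theorem coeff_zero_taylorExpand [CommRing K] (f : MvPolynomial σ K) :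
    coeff 0 (taylorExpand σ K f) = f := by
  have : ((constantCoeff (R := MvPolynomial σ K) (σ := σ)).comp
      (taylorExpand σ K).toRingHom) = RingHom.id _ := by
    apply MvPolynomial.ringHom_ext
    · intro r
      simp [taylorExpand, MvPolynomial.algebraMap_apply]
    · intro i
      simp [taylorExpand]
  simpa [constantCoeff_eq] using congrArg (fun φ => φ f) this

theorem le_differentialPower_one [CommRing K] (J : Ideal (MvPolynomial σ K)) :
    J ≤ differentialPower J 1 := fun f hf => mem_differentialPower.2 fun α hα => by
  obtain rfl : α = 0 := by
    rw [← Finsupp.degree_eq_zero_iff]; omega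
  rwa [coeff_zero_taylorExpand]

theorem pow_le_differentialPower [CommRing K] (J : Ideal (MvPolynomial σ K)) (s : ℕ) :
    J ^ s ≤ differentialPower J s := by
  refine le_trans (Ideal.pow_right_mono (le_differentialPower_one J) s) ?_
  rw [differentialPower, differentialPower, pow_one]
  exact Ideal.le_comap_pow _ s

/-- In lowest degree, multiplication by `p` is multiplication by its constant term, which cancels in
a domain; induction raises the order of `q` one degree at a time. -/
theorem mem_pow_idealOfVars_of_mul_mem {A : Type*} [CommRing A] [IsDomain A] {s : ℕ}
    {p q : MvPolynomial σ A} (hp : constantCoeff p ≠ 0) (h : p * q ∈ idealOfVars σ A ^ s) :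
    q ∈ idealOfVars σ A ^ s := by
  suffices H : ∀ k ≤ s, q ∈ idealOfVars σ A ^ k from H s le_rfl
  intro k
  induction k with
  | zero => simp
  | succ k ih =>
    intro hk
    have hq := ih (by omega)
    have hp' : p - C (constantCoeff p) ∈ idealOfVars σ A := by
      rw [← pow_one (idealOfVars σ A), mem_pow_idealOfVars_iff']
      intro x hx
      obtain rfl : x = 0 := by
        rw [← Finsupp.degree_eq_zero_iff]; omega
      simp [constantCoeff_eq]
    have h1 : C (constantCoeff p) * q ∈ idealOfVars σ A ^ (k + 1) := by
      have e : C (constantCoeff p) * q = p * q - (p - C (constantCoeff p)) * q := by ring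
      rw [e]
      refine Ideal.sub_mem _ (Ideal.pow_le_pow_right hk h) ?_
      rw [pow_succ']
      exact Ideal.mul_mem_mul hp' hq
    rw [mem_pow_idealOfVars_iff'] at h1 ⊢
    intro x hx
    have := h1 x hx
    rw [coeff_C_mul] at this
    exact (mul_eq_zero.1 this).resolve_left hp

/-- Modulo a minimal prime P the Taylor expansion of the multiplier `a` has nonzero constant term,
so it cancels over the domain R/P. Radicality recovers J as the intersection of the P. -/
theorem symbolicPower_le_differentialPower [CommRing K] {J : Ideal (MvPolynomial σ K)}
    (hJ : J.IsRadical) (s : ℕ) : symbolicPower J s ≤ differentialPower J s := by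
  rintro f ⟨a, ha, haf⟩
  have key : ∀ P ∈ J.minimalPrimes, f ∈ differentialPower P s := by
    intro P hP
    have := hP.1.1
    have h1 : a * f ∈ differentialPower P s :=
      pow_le_differentialPower P s (Ideal.pow_right_mono hP.1.2 s haf)
    rw [differentialPower, Ideal.mem_comap, map_mul] at h1
    refine mem_pow_idealOfVars_of_mul_mem ?_ h1
    have e : constantCoeff ((map (Ideal.Quotient.mk P)) (taylorExpand σ K a)) =
        Ideal.Quotient.mk P a := by
      rw [constantCoeff_eq, coeff_map, coeff_zero_taylorExpand]
    change constantCoeff ((map (Ideal.Quotient.mk P)) (taylorExpand σ K a)) ≠ 0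
    rw [e, Ne, Ideal.Quotient.eq_zero_iff_mem]
    exact ha P hP
  refine mem_differentialPower.2 fun α hα => ?_
  rw [← hJ.radical, ← Ideal.sInf_minimalPrimes, Ideal.mem_sInf]
  exact fun {P} hP => mem_differentialPower.1 (key P hP) α hα

end Taylor

/-! ### The Zariski–Nagata theorem, via formal smoothness of residue fields -/

section ZariskiNagata

theorem ker_factor_pow_self {B : Type*} [CommRing B] {I : Ideal B} {s : ℕ} (h : I ^ s ≤ I) :
    RingHom.ker (Ideal.Quotient.factor h) ^ s = ⊥ := by
  rw [Ideal.Quotient.factor_ker, ← Ideal.map_pow, Ideal.map_quotient_self]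

/-- Formal smoothness gives a section τ of the nilpotent thickening `g`. Writing φ(X_j) =
τ(g(φ(X_j))) + ε_j with ε_j in the kernel, φ(f) is a Taylor expansion in the ε_j: the terms of order
below `s` vanish by hypothesis, the others because the kernel has `s`-th power zero. -/
theorem map_eq_zero_of_coeff_taylorExpand {σ K A κ : Type*} [CommRing K] [CommRing A] [Algebra K A]
    [CommRing κ] [Algebra K κ] [Algebra.FormallySmooth K κ] (g : A →ₐ[K] κ)
    (hg : Function.Surjective g) {s : ℕ} (hker : RingHom.ker (g : A →+* κ) ^ s = ⊥)
    (φ : MvPolynomial σ K →ₐ[K] A) {f : MvPolynomial σ K}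
    (hf : ∀ α : σ →₀ ℕ, α.degree < s → g (φ (coeff α (taylorExpand σ K f))) = 0) : φ f = 0 := by
  let τ : κ →ₐ[K] A := Algebra.FormallySmooth.liftOfSurjective (AlgHom.id K κ) g hg ⟨s, hker⟩
  have hτ : ∀ x, g (τ x) = x := fun x =>
    Algebra.FormallySmooth.liftOfSurjective_apply (AlgHom.id K κ) g hg ⟨s, hker⟩ x
  let Ψ : MvPolynomial σ κ →+* A := eval₂Hom τ.toRingHom fun j => φ (X j) - τ (g (φ (X j)))
  let θ : MvPolynomial σ K →+* MvPolynomial σ κ :=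
    (map (g.comp φ).toRingHom).comp (taylorExpand σ K).toRingHom
  have hθ : θ f ∈ idealOfVars σ κ ^ s := by
    rw [mem_pow_idealOfVars_iff']
    intro α hα
    change coeff α ((map (g.comp φ).toRingHom) (taylorExpand σ K f)) = 0
    rw [coeff_map]
    exact hf α hα
  have hcomp : Ψ.comp θ = φ.toRingHom := by
    apply MvPolynomial.ringHom_ext
    · intro r
      simp only [Ψ, θ, taylorExpand, RingHom.comp_apply, AlgHom.toRingHom_eq_coe, RingHom.coe_coe,
        aeval_C, MvPolynomial.algebraMap_apply, map_C, eval₂Hom_C, AlgHom.comp_apply]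
      simp only [← MvPolynomial.algebraMap_eq, AlgHom.commutes, Algebra.algebraMap_self,
        RingHom.id_apply]
    · intro i
      simp [Ψ, θ, taylorExpand]
  have hΨ : (idealOfVars σ κ).map Ψ ≤ RingHom.ker (g : A →+* κ) := by
    rw [idealOfVars, Ideal.map_span, Ideal.span_le]
    rintro _ ⟨_, ⟨i, rfl⟩, rfl⟩
    simp [Ψ, hτ, RingHom.mem_ker]
  have h0 : Ψ (θ f) ∈ RingHom.ker (g : A →+* κ) ^ s :=
    Ideal.pow_right_mono hΨ s (by rw [← Ideal.map_pow]; exact Ideal.mem_map_of_mem _ hθ)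
  rw [hker, ← RingHom.comp_apply, hcomp] at h0
  exact h0

variable {σ K : Type*} [Finite σ] [Field K] [PerfectField K]

/-- The residue field is a finitely generated extension of a perfect field. -/
instance (P : Ideal (MvPolynomial σ K)) [P.IsPrime] :
    Algebra.FormallySmooth K (IsLocalRing.ResidueField (Localization.AtPrime P)) := by
  have : Algebra.EssFiniteType (MvPolynomial σ K) (Localization.AtPrime P) :=
    Algebra.EssFiniteType.of_isLocalization _ P.primeCompl
  have : Algebra.EssFiniteType K (Localization.AtPrime P) :=
    Algebra.EssFiniteType.comp K (MvPolynomial σ K) (Localization.AtPrime P)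
  have : Algebra.EssFiniteType K (IsLocalRing.ResidueField (Localization.AtPrime P)) :=
    Algebra.EssFiniteType.comp K (Localization.AtPrime P) _
  infer_instance

theorem algebraMap_mem_maximalIdeal_pow (P : Ideal (MvPolynomial σ K)) [P.IsPrime]
    {s : ℕ} (hs : 1 ≤ s) {f : MvPolynomial σ K} (hf : f ∈ differentialPower P s) :
    algebraMap _ (Localization.AtPrime P) f ∈
      IsLocalRing.maximalIdeal (Localization.AtPrime P) ^ s := by
  have hle : IsLocalRing.maximalIdeal (Localization.AtPrime P) ^ s ≤
    IsLocalRing.maximalIdeal (Localization.AtPrime P) := Ideal.pow_le_self (by omega)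
  rw [← Ideal.Quotient.eq_zero_iff_mem]
  refine map_eq_zero_of_coeff_taylorExpand (K := K)
    (A := Localization.AtPrime P ⧸ IsLocalRing.maximalIdeal (Localization.AtPrime P) ^ s)
    (κ := IsLocalRing.ResidueField (Localization.AtPrime P))
    (Ideal.Quotient.factorₐ K hle) (Ideal.Quotient.factor_surjective hle)
    (ker_factor_pow_self hle)
    ((Ideal.Quotient.mkₐ K _).comp
      (IsScalarTower.toAlgHom K (MvPolynomial σ K) (Localization.AtPrime P))) fun α hα => ?_
  change IsLocalRing.residue _ (algebraMap _ (Localization.AtPrime P) _) = 0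
  rw [IsLocalRing.residue_eq_zero_iff, ← Localization.AtPrime.map_eq_maximalIdeal]
  exact Ideal.mem_map_of_mem _ (mem_differentialPower.1 hf α hα)

/-- A Zariski–Nagata theorem over perfect fields. -/
theorem symbolicPower_eq_differentialPower {J : Ideal (MvPolynomial σ K)} (hJ : J.IsRadical)
    (s : ℕ) : symbolicPower J s = differentialPower J s := by
  refine le_antisymm (symbolicPower_le_differentialPower hJ s) fun f hf => ?_
  rcases Nat.eq_zero_or_pos s with rfl | hs
  · exact ⟨1, fun _ hP h => hP.1.1.ne_top ((Ideal.eq_top_iff_one _).2 h), by simp⟩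
  have key : ∀ P ∈ J.minimalPrimes, ∃ a ∉ P, a * f ∈ J ^ s := by
    intro P hP
    have := hP.1.1
    have h1 := algebraMap_mem_maximalIdeal_pow P hs
      (differentialPower_mono hP.1.2 s hf)
    -- As `P` is minimal over the radical ideal `J`, localizing at `P` makes `J` the maximal ideal.
    have h2 : IsLocalRing.maximalIdeal (Localization.AtPrime P) =
        J.map (algebraMap _ (Localization.AtPrime P)) := by
      rw [← Localization.AtPrime.map_eq_maximalIdeal,
        ← IsLocalization.AtPrime.radical_map_of_mem_minimalPrimes (Localization.AtPrime P) P J hP,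
        ← IsLocalization.map_radical P.primeCompl, hJ.radical]
    rw [h2, ← Ideal.map_pow, IsLocalization.algebraMap_mem_map_algebraMap_iff P.primeCompl] at h1
    exact h1
  -- A single multiplier must avoid all minimal primes at once: this is prime avoidance for the
  -- colon ideal.
  let Q : Ideal (MvPolynomial σ K) := (J ^ s).colon {f}
  by_contra hcon
  have hsub : (Q : Set (MvPolynomial σ K)) ⊆ ⋃ P ∈ J.minimalPrimes, (P : Set _) := by
    intro a ha
    by_contra hb
    refine hcon ⟨a, fun P hP h => hb (Set.mem_biUnion hP h), ?_⟩
    simpa [Q, Submodule.mem_colon_singleton] using ha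
  have hfin := J.finite_minimalPrimes_of_isNoetherianRing
  rw [← hfin.coe_toFinset] at hsub
  obtain ⟨P, hP, hQP⟩ := (Ideal.subset_union_prime (f := fun P => P) ⊥ ⊥
    (fun P hP _ _ => (hfin.mem_toFinset.1 hP).1.1)).1 hsub
  obtain ⟨a, ha, haf⟩ := key P (hfin.mem_toFinset.1 hP)
  exact ha (hQP (by simpa [Q, Submodule.mem_colon_singleton] using haf))

end ZariskiNagata

/-! ### Initial ideals and differential powers -/

section InitialIdeal

variable {σ K : Type*}

theorem coeff_add_ne_zero_of_coeff_taylorExpand_monomial [CommRing K] (m : σ →₀ ℕ) (c : K)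
    {α β : σ →₀ ℕ} (h : coeff β (coeff α (taylorExpand σ K (monomial m c))) ≠ 0) :
    coeff (α + β) (monomial m c) ≠ 0 := by
  classical
  suffices H : ∀ α β : σ →₀ ℕ, coeff β (coeff α (taylorExpand σ K (monomial m c))) ≠ 0 →
    coeff (α + β) (monomial m c) ≠ 0 from H α β h
  refine induction_on_monomial (motive := fun p => ∀ α β : σ →₀ ℕ,
    coeff β (coeff α (taylorExpand σ K p)) ≠ 0 → coeff (α + β) p ≠ 0) ?_ ?_ m c
  · intro a α β h
    have e : taylorExpand σ K (C a) = C (C a) := by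
      simp [taylorExpand, MvPolynomial.algebraMap_apply]
    rw [e, coeff_C] at h
    split_ifs at h with h0
    · subst h0
      simpa using h
    · simp at h
  · intro p n ih α β h
    have e : taylorExpand σ K (p * X n) =
        C (X n) * taylorExpand σ K p + taylorExpand σ K p * X n := by
      simp [taylorExpand]
      ring
    rw [e, coeff_add, coeff_add, coeff_C_mul, mul_comm (X n), coeff_mul_X', coeff_mul_X'] at h
    have hsplit : ∀ γ : σ →₀ ℕ, n ∈ γ.support → ∃ δ, γ = δ + Finsupp.single n 1 := fun γ hγ =>
      ⟨γ - Finsupp.single n 1, (tsub_add_cancel_of_le (Finsupp.single_le_iff.2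
        (Nat.one_le_iff_ne_zero.2 (Finsupp.mem_support_iff.1 hγ)))).symm⟩
    have hne : ∀ {a b : K}, a + b ≠ 0 → a ≠ 0 ∨ b ≠ 0 := fun hab =>
      not_and_or.1 fun h' => hab (by rw [h'.1, h'.2, add_zero])
    rcases hne h with h | h
    · split_ifs at h with hβ
      · obtain ⟨δ, rfl⟩ := hsplit β hβ
        rw [← add_assoc, coeff_mul_X]
        exact ih α δ (by simpa using h)
      · exact absurd rfl h
    · split_ifs at h with hα
      · obtain ⟨δ, rfl⟩ := hsplit α hα
        rw [add_right_comm, coeff_mul_X]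
        exact ih δ β (by simpa using h)
      · exact absurd (coeff_zero _) h

/-- Hasse derivatives are diagonal on monomials: x^(α+β) goes to a scalar multiple of x^β, and
nothing else contributes to x^β. -/
theorem coeff_coeff_taylorExpand [CommRing K] (f : MvPolynomial σ K) (α β : σ →₀ ℕ) :
    coeff β (coeff α (taylorExpand σ K f)) =
      coeff (α + β) f * coeff β (coeff α (taylorExpand σ K (monomial (α + β) 1))) := by
  classical
  induction f using MvPolynomial.induction_on' with
  | monomial m c =>
    by_cases hm : m = α + β
    · subst hm
      have e : monomial (α + β) c = c • (monomial (α + β) 1 : MvPolynomial σ K) := by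
        simp [smul_monomial]
      rw [e, map_smul]
      simp
    · have h0 : coeff (α + β) (monomial m c) = 0 := by simp [coeff_monomial, hm]
      rw [h0, zero_mul]
      by_contra h
      exact coeff_add_ne_zero_of_coeff_taylorExpand_monomial m c h h0
  | add p q hp hq => rw [map_add, coeff_add, coeff_add, hp, hq, coeff_add, add_mul]

variable [Field K] (m : MonomialOrder σ)

/-- Translation by α preserves the term order, so a nonzero α-th derivative of the leading term is
the leading term of the α-th derivative `D` of `f`. -/
theorem leadingTerm_mem_differentialPower {J : Ideal (MvPolynomial σ K)} {s : ℕ}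
    {f : MvPolynomial σ K} (hf : f ∈ differentialPower J s) :
    m.leadingTerm f ∈ differentialPower (initialIdeal m J) s := by
  classical
  refine mem_differentialPower.2 fun α hα => ?_
  have hD := mem_differentialPower.1 hf α hα
  set D := coeff α (taylorExpand σ K f) with hDdef
  have hlt : m.leadingTerm f = monomial (m.degree f) (m.leadingCoeff f) := rfl
  by_cases h0 : coeff α (taylorExpand σ K (m.leadingTerm f)) = 0
  · rw [h0]; exact zero_mem _
  obtain ⟨β, hβ⟩ := ne_zero_iff.1 h0
  have h1 := hβ
  rw [coeff_coeff_taylorExpand] at h1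
  have hdeg : m.degree f = α + β := by
    by_contra h
    rw [hlt, coeff_monomial, if_neg h, zero_mul] at h1
    exact h1 rfl
  have hcoeff : ∀ γ, coeff γ D = coeff (α + γ) f *
    coeff γ (coeff α (taylorExpand σ K (monomial (α + γ) 1))) := fun γ =>
      coeff_coeff_taylorExpand f α γ
  have hβD : coeff β D = coeff β (coeff α (taylorExpand σ K (m.leadingTerm f))) := by
    rw [hcoeff, coeff_coeff_taylorExpand (m.leadingTerm f), hlt, ← hdeg, coeff_monomial,
      if_pos rfl]
    rfl
  have hDβ : m.degree D = β := by
    apply m.toSyn.injective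
    refine le_antisymm ?_ ?_
    · rw [m.degree_le_iff]
      intro γ hγ
      have h2 : coeff (α + γ) f ≠ 0 := by
        intro h
        rw [mem_support_iff, hcoeff, h, zero_mul] at hγ
        exact hγ rfl
      have h3 := m.le_degree (mem_support_iff.2 h2)
      rw [hdeg, map_add, map_add] at h3
      exact le_of_add_le_add_left h3
    · refine m.le_degree (mem_support_iff.2 ?_)
      rw [hβD]
      exact hβ
  have : coeff α (taylorExpand σ K (m.leadingTerm f)) = m.leadingTerm D := by
    ext γ
    have e : m.leadingTerm D = monomial β (coeff β D) := by
      rw [MonomialOrder.leadingTerm, MonomialOrder.leadingCoeff, hDβ]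
    rw [e, coeff_monomial]
    split_ifs with h
    · rw [← h, hβD]
    · rw [coeff_coeff_taylorExpand, hlt, coeff_monomial, if_neg, zero_mul]
      rw [hdeg]
      exact fun h' => h (add_left_cancel h')
  rw [this]
  exact Ideal.subset_span ⟨D, hD, rfl⟩

theorem exists_degree_le_of_leadingTerm_mem {B : Set (MvPolynomial σ K)} {f : MvPolynomial σ K}
    (hf : f ≠ 0) (h : m.leadingTerm f ∈ Ideal.span (m.leadingTerm '' B)) :
    ∃ b ∈ B, b ≠ 0 ∧ m.degree b ≤ m.degree f := by
  classical
  rw [m.span_leadingTerm_eq_span_monomial',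
    ← Set.image_image (fun d => monomial d (1 : K)) m.degree, mem_ideal_span_monomial_image] at h
  obtain ⟨_, ⟨b, hb, rfl⟩, hle⟩ := h (m.degree f) (by
    rw [m.support_leadingTerm' hf]; simp)
  exact ⟨b, hb.1, hb.2, hle⟩

/-- A nonzero remainder of an element of `L` on division by `N` would have a leading monomial
divisible by one from `N`. -/
theorem eq_of_initialIdeal_le {N L : Ideal (MvPolynomial σ K)} (h : N ≤ L)
    (hin : initialIdeal m L ≤ initialIdeal m N) : N = L := by
  refine le_antisymm h fun f hf => ?_
  obtain ⟨g, r, hfr, -, hr⟩ := m.div_set (B := (N : Set (MvPolynomial σ K)) \ {0})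
    (fun b hb => (m.leadingCoeff_ne_zero_iff.2 hb.2).isUnit) f
  have hsum : Finsupp.linearCombination (MvPolynomial σ K)
      (fun b : ((N : Set (MvPolynomial σ K)) \ {0} : Set _) => (b : MvPolynomial σ K)) g ∈ N :=
    Submodule.sum_mem _ fun b _ => N.mul_mem_left _ b.2.1
  by_cases hr0 : r = 0
  · rw [hfr, hr0, add_zero]
    exact hsum
  have hrL : r ∈ L := by
    rw [eq_sub_of_add_eq' hfr.symm]
    exact L.sub_mem hf (h hsum)
  obtain ⟨b, hb, hb0, hle⟩ := exists_degree_le_of_leadingTerm_mem m hr0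
    (hin (Ideal.subset_span ⟨r, hrL, rfl⟩))
  exact absurd hle (hr _ (m.degree_mem_support hr0) b ⟨hb, hb0⟩)

theorem initialIdeal_symbolicPower_le [PerfectField K] [Finite σ] {J : Ideal (MvPolynomial σ K)}
    (hJ : J.IsRadical) (hin : (initialIdeal m J).IsRadical) (s : ℕ) :
    initialIdeal m (symbolicPower J s) ≤ symbolicPower (initialIdeal m J) s := by
  rw [symbolicPower_eq_differentialPower hJ, symbolicPower_eq_differentialPower hin, initialIdeal,
    Ideal.span_le]
  rintro _ ⟨f, hf, rfl⟩
  exact leadingTerm_mem_differentialPower m hf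

end InitialIdeal

/-! ### Iterated sumsets -/

section Sumset

open scoped Pointwise

/-- The `r`-fold sumset `V + ⋯ + V`. -/
def iteratedSumset {M : Type*} [AddMonoid M] (V : Set M) : ℕ → Set M
  | 0 => {0}
  | r + 1 => iteratedSumset V r + V

variable {M : Type*} [AddCommMonoid M] {V : Set M}

theorem iteratedSumset_one (V : Set M) : iteratedSumset V 1 = V := by
  simp [iteratedSumset]

theorem iteratedSumset_add (V : Set M) (a b : ℕ) :
    iteratedSumset V (a + b) = iteratedSumset V a + iteratedSumset V b := by
  induction b with
  | zero => simp [iteratedSumset]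
  | succ b ih => rw [← add_assoc, iteratedSumset, ih, iteratedSumset, add_assoc]

theorem iteratedSumset_mono (h0 : (0 : M) ∈ V) {a b : ℕ} (hab : a ≤ b) :
    iteratedSumset V a ⊆ iteratedSumset V b := by
  induction b, hab using Nat.le_induction with
  | base => exact subset_rfl
  | succ b _ ih => exact fun x hx => ⟨x, ih hx, 0, h0, add_zero x⟩

theorem sum_mem_iteratedSumset {ι : Type*} (s : Finset ι) (v : ι → M) (hv : ∀ i ∈ s, v i ∈ V) :
    ∑ i ∈ s, v i ∈ iteratedSumset V s.card := by
  classical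
  induction s using Finset.induction_on with
  | empty => simp [iteratedSumset]
  | insert i s hi ih =>
    rw [Finset.sum_insert hi, Finset.card_insert_of_notMem hi, add_comm (v i)]
    exact ⟨_, ih fun j hj => hv j (Finset.mem_insert_of_mem hj), _,
      hv i (Finset.mem_insert_self i s), rfl⟩

theorem nonempty_of_mem_iteratedSumset {r : ℕ} (hr : 1 ≤ r) {x : M}
    (hx : x ∈ iteratedSumset V r) : V.Nonempty := by
  obtain ⟨r, rfl⟩ := Nat.exists_eq_add_of_le' hr
  obtain ⟨_, _, v, hv, _⟩ := hx
  exact ⟨v, hv⟩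

end Sumset

/-! ### Secant ideals as vanishing ideals of sumsets -/

section Join

open scoped Pointwise

variable {σ K : Type*} [Field K]

theorem vanishingIdeal_isRadical (V : Set (σ → K)) : (vanishingIdeal K V).IsRadical := by
  rintro f ⟨n, hn⟩ x hx
  have := hn x hx
  rw [map_pow] at this
  exact eq_zero_of_pow_eq_zero this

theorem aeval_add_eq_sum_taylorExpand {S : Type*} [CommRing S] [Algebra K S]
    (φ ψ : MvPolynomial σ K →ₐ[K] S) (f : MvPolynomial σ K) :
    aeval (fun i => φ (X i) + ψ (X i)) f =
      ∑ α ∈ (taylorExpand σ K f).support,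
        φ (coeff α (taylorExpand σ K f)) * ψ (monomial α 1) := by
  have h : (eval₂Hom φ.toRingHom fun i => ψ (X i)).comp (taylorExpand σ K).toRingHom =
      (aeval (R := K) fun i => φ (X i) + ψ (X i)).toRingHom := by
    apply MvPolynomial.ringHom_ext
    · intro r
      simp only [taylorExpand, RingHom.comp_apply, AlgHom.toRingHom_eq_coe, RingHom.coe_coe,
        aeval_C, MvPolynomial.algebraMap_apply, eval₂Hom_C]
      simp only [← MvPolynomial.algebraMap_eq, AlgHom.commutes, Algebra.algebraMap_self,
        RingHom.id_apply]
    · intro i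
      simp [taylorExpand]
  have h' := congrArg (fun χ => χ f) h
  change eval₂ φ.toRingHom (fun i => ψ (X i)) (taylorExpand σ K f) = _ at h'
  change (aeval (R := K) fun i => φ (X i) + ψ (X i)).toRingHom f = _
  rw [← h', eval₂_eq]
  refine Finset.sum_congr rfl fun α _ => ?_
  rw [monomial_eq, C_1, one_mul, Finsupp.prod, map_prod]
  simp only [map_pow]
  rfl

theorem aeval_add_eq_sum (f : MvPolynomial σ K) (p q : σ → K) :
    aeval (p + q) f = ∑ α ∈ (taylorExpand σ K f).support,
      aeval p (coeff α (taylorExpand σ K f)) * aeval q (monomial α (1 : K)) := by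
  rw [← aeval_add_eq_sum_taylorExpand (aeval p) (aeval q)]
  simp only [aeval_X]
  rfl

/-- This is the injectivity of K[A] ⊗ K[B] into functions on A × B, by elimination. If `b j` is
nonzero at some `q₀` in `B`, evaluating there expresses `a j` modulo the ideal of `A` through the
other `a i`; substituting shortens the sum. It holds over any field. -/
theorem sum_mul_mem_of_vanishing {S ι : Type*} [CommRing S] [Algebra K S]
    (φ ψ : MvPolynomial σ K →ₐ[K] S) {A B : Set (σ → K)} {N : Ideal S}
    (hA : ∀ f ∈ vanishingIdeal K A, φ f ∈ N) (hB : ∀ f ∈ vanishingIdeal K B, ψ f ∈ N)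
    (s : Finset ι) (a b : ι → MvPolynomial σ K)
    (h : ∀ p ∈ A, ∀ q ∈ B, ∑ i ∈ s, aeval p (a i) * aeval q (b i) = 0) :
    ∑ i ∈ s, φ (a i) * ψ (b i) ∈ N := by
  classical
  induction s using Finset.induction_on generalizing b with
  | empty => simp
  | insert j s hj ih =>
    simp only [Finset.sum_insert hj] at h ⊢
    by_cases hb : b j ∈ vanishingIdeal K B
    · refine N.add_mem (N.mul_mem_left _ (hB _ hb)) (ih b fun p hp q hq => ?_)
      have := h p hp q hq
      rwa [hb q hq, mul_zero, zero_add] at this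
    · rw [mem_vanishingIdeal_iff] at hb
      push Not at hb
      obtain ⟨q₀, hq₀, hne⟩ := hb
      set c : ι → K := fun i => aeval q₀ (b i) / aeval q₀ (b j) with hc
      have hg : a j + ∑ i ∈ s, C (c i) * a i ∈ vanishingIdeal K A := by
        intro p hp
        have h1 := h p hp q₀ hq₀
        rw [map_add, map_sum]
        have h2 : (∑ i ∈ s, aeval p (C (c i) * a i)) * aeval q₀ (b j) =
            ∑ i ∈ s, aeval p (a i) * aeval q₀ (b i) := by
          rw [Finset.sum_mul]
          refine Finset.sum_congr rfl fun i _ => ?_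
          rw [map_mul, aeval_C, Algebra.algebraMap_self, RingHom.id_apply, hc]
          field_simp
        refine (mul_eq_zero.1 ?_).resolve_right hne
        rw [add_mul, h2, h1]
      have e : φ (a j) * ψ (b j) + ∑ i ∈ s, φ (a i) * ψ (b i) =
          φ (a j + ∑ i ∈ s, C (c i) * a i) * ψ (b j) +
            ∑ i ∈ s, φ (a i) * ψ (b i - C (c i) * b j) := by
        have hC : ∀ (χ : MvPolynomial σ K →ₐ[K] S) (x : K), χ (C x) = algebraMap K S x :=
          fun χ x => by rw [← MvPolynomial.algebraMap_eq, AlgHom.commutes]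
        simp only [map_add, map_sub, map_mul, map_sum, hC, add_mul, Finset.sum_mul, mul_sub,
          Finset.sum_sub_distrib]
        rw [add_assoc]
        congr 1
        have : ∑ i ∈ s, (algebraMap K S) (c i) * φ (a i) * ψ (b j) =
            ∑ i ∈ s, φ (a i) * ((algebraMap K S) (c i) * ψ (b j)) :=
          Finset.sum_congr rfl fun i _ => by ring
        rw [this]
        ring
      rw [e]
      refine N.add_mem (N.mul_mem_right _ (hA _ hg)) (ih _ fun p hp q hq => ?_)
      have h1 := h p hp q hq
      have h2 := hg p hp
      rw [map_add, map_sum] at h2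
      simp only [map_mul, map_sub, aeval_C, Algebra.algebraMap_self, RingHom.id_apply, mul_sub,
        Finset.sum_sub_distrib] at h2 ⊢
      have h3 : ∑ i ∈ s, aeval p (a i) * (c i * aeval q (b j)) =
          (∑ i ∈ s, c i * aeval p (a i)) * aeval q (b j) := by
        rw [Finset.sum_mul]
        exact Finset.sum_congr rfl fun i _ => by ring
      rw [h3, eq_neg_of_add_eq_zero_right h2]
      linear_combination h1

theorem joinIdeal_vanishingIdeal (A B : Set (σ → K)) :
    joinIdeal (vanishingIdeal K A) (vanishingIdeal K B) = vanishingIdeal K (A + B) := by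
  apply le_antisymm
  · rintro f hf _ ⟨p, hp, q, hq, rfl⟩
    let w : σ ⊕ (σ ⊕ σ) → K := Sum.elim (p + q) (Sum.elim p q)
    have hle := Ideal.mem_comap.1 hf
    have h0 : rename (Sum.inl : σ → σ ⊕ (σ ⊕ σ)) f ∈ RingHom.ker (aeval (R := K) w) := by
      refine SetLike.le_def.1 (sup_le (sup_le ?_ ?_) ?_) hle
      · rw [Ideal.map_le_iff_le_comap]
        intro g hg
        rw [Ideal.mem_comap, RingHom.mem_ker, aeval_rename]
        exact hg p hp
      · rw [Ideal.map_le_iff_le_comap]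
        intro g hg
        rw [Ideal.mem_comap, RingHom.mem_ker, aeval_rename]
        exact hg q hq
      · rw [Ideal.span_le]
        rintro _ ⟨i, rfl⟩
        simp [RingHom.mem_ker, w]
    rw [RingHom.mem_ker, aeval_rename] at h0
    exact h0
  · intro f hf
    rw [joinIdeal, Ideal.mem_comap]
    set φ := rename (R := K) (fun i : σ => (Sum.inr (Sum.inl i) : σ ⊕ (σ ⊕ σ)))
    set ψ := rename (R := K) (fun i : σ => (Sum.inr (Sum.inr i) : σ ⊕ (σ ⊕ σ)))
    set D := Ideal.span (Set.range fun i : σ =>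
        (X (Sum.inl i) - X (Sum.inr (Sum.inl i)) - X (Sum.inr (Sum.inr i)) :
          MvPolynomial (σ ⊕ (σ ⊕ σ)) K))
    set N := Ideal.map φ (vanishingIdeal K A) ⊔ Ideal.map ψ (vanishingIdeal K B) ⊔ D
    have h1 : aeval (fun i => φ (X i) + ψ (X i)) f ∈ N := by
      rw [aeval_add_eq_sum_taylorExpand]
      refine sum_mul_mem_of_vanishing φ ψ (A := A) (B := B)
        (fun g hg => Ideal.mem_sup_left (Ideal.mem_sup_left (Ideal.mem_map_of_mem _ hg)))
        (fun g hg => Ideal.mem_sup_left (Ideal.mem_sup_right (Ideal.mem_map_of_mem _ hg)))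
        _ _ _ fun p hp q hq => ?_
      rw [← aeval_add_eq_sum]
      exact hf _ ⟨p, hp, q, hq, rfl⟩
    -- Modulo the relations x_i = y_i + z_i, f(x) equals f(y + z).
    have h2 : rename Sum.inl f - aeval (fun i => φ (X i) + ψ (X i)) f ∈ D := by
      rw [← Ideal.Quotient.mk_eq_mk_iff_sub_mem]
      have : (Ideal.Quotient.mkₐ K D).comp (rename Sum.inl) =
          (Ideal.Quotient.mkₐ K D).comp (aeval (fun i => φ (X i) + ψ (X i))) := by
        apply MvPolynomial.algHom_ext
        intro i
        simp only [AlgHom.comp_apply, rename_X, aeval_X, Ideal.Quotient.mkₐ_eq_mk]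
        rw [Ideal.Quotient.mk_eq_mk_iff_sub_mem]
        refine Ideal.subset_span ⟨i, ?_⟩
        simp [φ, ψ, sub_sub]
      exact congrArg (fun χ => χ f) this
    have h3 := N.add_mem (Ideal.mem_sup_right h2 : _ ∈ N) h1
    rwa [sub_add_cancel] at h3

theorem secantIdeal_vanishingIdeal (V : Set (σ → K)) {r : ℕ} (hr : 1 ≤ r) :
    secantIdeal (vanishingIdeal K V) r = vanishingIdeal K (iteratedSumset V r) := by
  induction r, hr using Nat.le_induction with
  | base => rw [iteratedSumset_one]; rfl
  | succ r hr ih =>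
    obtain ⟨r, rfl⟩ := Nat.exists_eq_add_of_le' hr
    rw [secantIdeal, ih, joinIdeal_vanishingIdeal]
    rfl

theorem Ideal.IsRadical.secantIdeal_eq [Finite σ] [IsAlgClosed K] {I : Ideal (MvPolynomial σ K)}
    (hI : I.IsRadical) {r : ℕ} (hr : 1 ≤ r) :
    secantIdeal I r = vanishingIdeal K (iteratedSumset (zeroLocus K I) r) := by
  rw [← secantIdeal_vanishingIdeal _ hr, vanishingIdeal_zeroLocus_eq_radical, hI.radical]

theorem Ideal.IsRadical.secantIdeal [Finite σ] [IsAlgClosed K] {I : Ideal (MvPolynomial σ K)}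
    (hI : I.IsRadical) {r : ℕ} (hr : 1 ≤ r) : (secantIdeal I r).IsRadical := by
  rw [hI.secantIdeal_eq hr]
  exact vanishingIdeal_isRadical _

end Join

/-! ### Vanishing on a sumset forces a high order of vanishing -/

section VanishingOrder

open scoped Pointwise

variable {σ K : Type*} [Field K]

theorem map_mem_pow_idealOfVars {ι : Type*} (φ : MvPolynomial ι K →ₐ[K] MvPolynomial σ K)
    (hφ : ∀ i, φ (X i) ∈ idealOfVars σ K) {s : ℕ} {f : MvPolynomial ι K}
    (hf : f ∈ idealOfVars ι K ^ s) : φ f ∈ idealOfVars σ K ^ s := by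
  have h : (idealOfVars ι K).map φ ≤ idealOfVars σ K := by
    rw [idealOfVars, Ideal.map_span, Ideal.span_le]
    rintro _ ⟨_, ⟨i, rfl⟩, rfl⟩
    exact hφ i
  exact Ideal.pow_right_mono h s (by rw [← Ideal.map_pow]; exact Ideal.mem_map_of_mem _ hf)

theorem coeff_aeval_ite {ι : Type*} (S : Finset ι) [DecidableEq ι] (h : MvPolynomial ι K)
    {γ : ι →₀ ℕ} (hγ : γ.support ⊆ S) :
    coeff γ (aeval (fun i => if i ∈ S then (X i : MvPolynomial ι K) else 0) h) = coeff γ h := by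
  set D : Ideal (MvPolynomial ι K) := Ideal.span (X '' {i | i ∉ S})
  have h1 : h - aeval (fun i => if i ∈ S then (X i : MvPolynomial ι K) else 0) h ∈ D := by
    rw [← Ideal.Quotient.mk_eq_mk_iff_sub_mem]
    have : Ideal.Quotient.mkₐ K D = (Ideal.Quotient.mkₐ K D).comp
        (aeval (fun i => if i ∈ S then (X i : MvPolynomial ι K) else 0)) := by
      apply MvPolynomial.algHom_ext
      intro i
      simp only [AlgHom.comp_apply, aeval_X, Ideal.Quotient.mkₐ_eq_mk]
      split_ifs with hi
      · rfl
      · rw [Ideal.Quotient.mk_eq_mk_iff_sub_mem, sub_zero]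
        exact Ideal.subset_span ⟨i, hi, rfl⟩
    exact congrArg (fun χ => χ h) this
  have h2 := mem_ideal_span_X_image.1 h1 γ
  by_contra hne
  obtain ⟨i, hi, hi'⟩ := h2 (by
    rw [mem_support_iff, coeff_sub, sub_ne_zero]
    exact fun h => hne h.symm)
  exact hi (hγ (Finsupp.mem_support_iff.2 hi'))

theorem card_support_le_degree {ι : Type*} (γ : ι →₀ ℕ) : γ.support.card ≤ γ.degree := by
  rw [Finset.card_eq_sum_ones]
  exact Finset.sum_le_sum fun i hi => Nat.one_le_iff_ne_zero.2 (Finsupp.mem_support_iff.1 hi)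

/-- In coordinates for a basis taken from `V`, a monomial of degree at most `s` involves at most `s`
basis vectors. Their span lies in the `s`-fold sumset of the cone, where `q` vanishes, so the
coefficient is zero because `K` is infinite. -/
theorem mem_pow_idealOfVars_of_vanishing [Finite σ] [Infinite K] {V : Set (σ → K)}
    (hcone : ∀ c : K, ∀ v ∈ V, c • v ∈ V) (h0 : 0 ∈ V) (hspan : Submodule.span K V = ⊤)
    {s : ℕ} {q : MvPolynomial σ K} (hq : ∀ z ∈ iteratedSumset V s, eval z q = 0) :
    q ∈ idealOfVars σ K ^ (s + 1) := by
  classical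
  have := Fintype.ofFinite σ
  obtain ⟨ι, b, hb⟩ : ∃ (ι : Type _) (b : Module.Basis ι K (σ → K)), ∀ i, b i ∈ V :=
    ⟨_, Module.Basis.ofSpan hspan.ge, fun i => Module.Basis.ofSpan_subset hspan.ge ⟨i, rfl⟩⟩
  have := Module.Finite.finite_basis b
  have := Fintype.ofFinite ι
  let h : MvPolynomial ι K := aeval (fun j => ∑ i, C (b i j) * X i) q
  have hh : ∀ z : ι → K, eval z h = eval (∑ i, z i • b i) q := by
    intro z
    have : (aeval z).comp (aeval (fun j => ∑ i, C (b i j) * (X i : MvPolynomial ι K))) =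
        aeval (R := K) (∑ i, z i • b i) := by
      apply MvPolynomial.algHom_ext
      intro j
      simp [Finset.sum_apply, mul_comm]
    exact congrArg (fun χ => χ q) this
  have hmem : h ∈ idealOfVars ι K ^ (s + 1) := by
    rw [mem_pow_idealOfVars_iff']
    intro γ hγ
    rw [← coeff_aeval_ite γ.support h subset_rfl]
    have : aeval (fun i => if i ∈ γ.support then (X i : MvPolynomial ι K) else 0) h = 0 := by
      apply MvPolynomial.funext
      intro z
      have e : eval z (aeval (fun i => if i ∈ γ.support then (X i : MvPolynomial ι K) else 0) h) =
          eval (fun i => if i ∈ γ.support then z i else 0) h := by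
        have : (aeval z).comp
            (aeval (fun i => if i ∈ γ.support then (X i : MvPolynomial ι K) else 0)) =
            aeval (R := K) (fun i => if i ∈ γ.support then z i else 0) := by
          apply MvPolynomial.algHom_ext
          intro j
          simp only [AlgHom.comp_apply, aeval_X]
          split_ifs <;> simp
        exact congrArg (fun χ => χ h) this
      rw [e, hh, map_zero]
      apply hq
      have e2 : ∑ i, (if i ∈ γ.support then z i else 0) • b i = ∑ i ∈ γ.support, z i • b i := by
        simp only [ite_smul, zero_smul, Finset.sum_ite_mem, Finset.univ_inter]
      rw [e2]
      refine iteratedSumset_mono h0 ?_ (sum_mem_iteratedSumset _ _ fun i _ => hcone _ _ (hb i))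
      have := card_support_le_degree γ
      omega
    rw [this, coeff_zero]
  -- The inverse coordinate change, which recovers `q` from `h` and preserves the order at the
  -- origin.
  let L : MvPolynomial ι K →ₐ[K] MvPolynomial σ K :=
    aeval fun i => ∑ j, C (b.repr (Pi.single j 1) i) * X j
  have hqL : q = L h := by
    apply MvPolynomial.funext
    intro z
    have e : eval z (L h) = eval (b.repr z) h := by
      have : (aeval z).comp L = aeval (R := K) (b.repr z) := by
        apply MvPolynomial.algHom_ext
        intro i
        have hz : z = ∑ j, z j • Pi.single j (1 : K) := by
          ext k
          simp [Finset.sum_apply, Pi.single_apply]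
        conv_rhs => rw [aeval_X, hz, map_sum]
        simp [L, mul_comm]
      exact congrArg (fun χ => χ h) this
    rw [e, hh, b.sum_repr]
  rw [hqL]
  refine map_mem_pow_idealOfVars L (fun i => ?_) hmem
  simp only [L, aeval_X]
  exact Ideal.sum_mem _ fun j _ => Ideal.mul_mem_left _ _ (Ideal.subset_span ⟨j, rfl⟩)

/-- For `p` in the `r`-fold sumset, f(p + z) vanishes for `z` in the `s`-fold one, hence has order
at least s + 1 in z; its coefficients are the Hasse derivatives of `f` at `p`. -/
theorem vanishingIdeal_iteratedSumset_le [Finite σ] [Infinite K] {V : Set (σ → K)}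
    (hcone : ∀ c : K, ∀ v ∈ V, c • v ∈ V) (hspan : V.Nonempty → Submodule.span K V = ⊤)
    {r : ℕ} (hr : 1 ≤ r) (s : ℕ) :
    vanishingIdeal K (iteratedSumset V (r + s)) ≤
      differentialPower (vanishingIdeal K (iteratedSumset V r)) (s + 1) := by
  refine fun f hf => mem_differentialPower.2 fun α hα p hp => ?_
  have hne := nonempty_of_mem_iteratedSumset hr hp
  have h0 : 0 ∈ V := by
    obtain ⟨v, hv⟩ := hne
    simpa using hcone 0 v hv
  have h1 : map (aeval p).toRingHom (taylorExpand σ K f) ∈ idealOfVars σ K ^ (s + 1) := by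
    refine mem_pow_idealOfVars_of_vanishing hcone h0 (hspan hne) fun z hz => ?_
    have e := aeval_add_eq_sum f p z
    rw [eval_map, eval₂_eq]
    have hz0 : aeval (p + z) f = 0 := hf _ (by rw [iteratedSumset_add]; exact ⟨p, hp, z, hz, rfl⟩)
    rw [← hz0, e]
    refine Finset.sum_congr rfl fun β _ => ?_
    rw [aeval_monomial, map_one, one_mul]
    rfl
  have h2 := mem_pow_idealOfVars_iff' _ _ |>.1 h1 α hα
  rw [coeff_map] at h2
  exact h2

end VanishingOrder

/-! ### The zero locus spans, and secant ideals lie in symbolic powers -/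

section Homogeneous

variable {σ K : Type*} [Field K]

theorem aeval_smul_of_isHomogeneous {f : MvPolynomial σ K} {d : ℕ} (hf : f.IsHomogeneous d) (c : K)
    (v : σ → K) : aeval (c • v) f = c ^ d * aeval v f := by
  rw [aeval_def, aeval_def, eval₂_eq, eval₂_eq, Finset.mul_sum]
  refine Finset.sum_congr rfl fun β hβ => ?_
  have hdeg : β.degree = d := by
    rw [← hf (mem_support_iff.1 hβ), Finsupp.degree_eq_weight_one (R := ℕ)]
    rfl
  have e : ∏ i ∈ β.support, (c • v) i ^ β i = c ^ d * ∏ i ∈ β.support, v i ^ β i := by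
    simp only [Pi.smul_apply, smul_eq_mul, mul_pow]
    rw [Finset.prod_mul_distrib, Finset.prod_pow_eq_pow_sum, ← hdeg]
    rfl
  rw [e]
  ring

theorem smul_mem_zeroLocus {I : Ideal (MvPolynomial σ K)}
    (hI : ∀ f ∈ I, ∀ d : ℕ, homogeneousComponent d f ∈ I) (c : K) {v : σ → K}
    (hv : v ∈ zeroLocus K I) : c • v ∈ zeroLocus K I := by
  intro f hf
  rw [← sum_homogeneousComponent f, map_sum]
  refine Finset.sum_eq_zero fun d _ => ?_
  have h := hv _ (hI f hf d)
  rw [aeval_smul_of_isHomogeneous (homogeneousComponent_isHomogeneous d f), h, mul_zero]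

theorem initialIdeal_ne_top (m : MonomialOrder σ) {I : Ideal (MvPolynomial σ K)} (h : I ≠ ⊤) :
    initialIdeal m I ≠ ⊤ := by
  intro htop
  have h1 : m.leadingTerm (1 : MvPolynomial σ K) ∈ Ideal.span (m.leadingTerm '' (I : Set _)) := by
    change _ ∈ initialIdeal m I
    rw [htop]
    trivial
  obtain ⟨b, hb, hb0, hle⟩ := exists_degree_le_of_leadingTerm_mem m one_ne_zero h1
  rw [m.degree_one, nonpos_iff_eq_zero] at hle
  have e := m.eq_C_of_degree_eq_zero hle
  refine h (Ideal.eq_top_of_isUnit_mem _ hb ?_)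
  rw [e]
  exact (IsUnit.mk0 _ (m.leadingCoeff_ne_zero_iff.2 hb0)).map C

/-- Linear forms are additive: x_i = y_i + z_i + (x_i - y_i - z_i). -/
theorem monomial_single_mem_secantIdeal_two {M : Ideal (MvPolynomial σ K)} {i : σ} {c : K}
    (h : C c * X i ∈ M) : C c * X i ∈ secantIdeal M 2 := by
  change _ ∈ joinIdeal M M
  rw [joinIdeal, Ideal.mem_comap]
  have e : rename (Sum.inl : σ → σ ⊕ (σ ⊕ σ)) (C c * X i : MvPolynomial σ K) =
      rename (fun i : σ => (Sum.inr (Sum.inl i) : σ ⊕ (σ ⊕ σ))) (C c * X i : MvPolynomial σ K) +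
      rename (fun i : σ => (Sum.inr (Sum.inr i) : σ ⊕ (σ ⊕ σ))) (C c * X i : MvPolynomial σ K) +
      C c * (X (Sum.inl i) - X (Sum.inr (Sum.inl i)) - X (Sum.inr (Sum.inr i))) := by
    simp
    ring
  rw [e]
  exact Submodule.add_mem_sup
    (Submodule.add_mem_sup (Ideal.mem_map_of_mem _ h) (Ideal.mem_map_of_mem _ h))
    (Ideal.mul_mem_left _ _ (Ideal.subset_span ⟨i, rfl⟩))

theorem C_mul_X_notMem_differentialPower {M : Ideal (MvPolynomial σ K)} (hM : M ≠ ⊤) {i : σ}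
    {c : K} (hc : c ≠ 0) : C c * X i ∉ differentialPower M 2 := by
  classical
  intro h
  have h1 := mem_differentialPower.1 h (Finsupp.single i 1) (by simp)
  have e : taylorExpand σ K (C c * X i) = C (C c) * (C (X i) + X i) := by
    simp [taylorExpand, MvPolynomial.algebraMap_apply]
  rw [e, coeff_C_mul, coeff_add, coeff_C, if_neg (Finsupp.single_ne_zero.2 one_ne_zero).symm, coeff_X, if_pos rfl, zero_add, mul_one] at h1
  exact hM (Ideal.eq_top_of_isUnit_mem _ h1 ((IsUnit.mk0 _ hc).map C))

variable [Finite σ] [IsAlgClosed K]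

/-- A linear form vanishing on the locus lies in the radical ideal `I`. Its leading term, a scalar
times a variable, would lie in the second symbolic power of in(I), although one of its first
derivatives is a unit. -/
theorem span_zeroLocus_eq_top (m : MonomialOrder σ) {I : Ideal (MvPolynomial σ K)}
    (hrad : I.IsRadical) (hin : (initialIdeal m I).IsRadical)
    (h2 : secantIdeal (initialIdeal m I) 2 ≤ symbolicPower (initialIdeal m I) 2)
    (hne : (zeroLocus K I).Nonempty) : Submodule.span K (zeroLocus K I) = ⊤ := by
  classical
  have := Fintype.ofFinite σ
  by_contra hspan
  obtain ⟨l, hl0, hl⟩ := Submodule.exists_le_ker_of_lt_top _ (lt_top_iff_ne_top.2 hspan)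
  let L : MvPolynomial σ K := ∑ i, C (l (Pi.single i 1)) * X i
  have hLcoeff : ∀ d ∈ L.support, ∃ i, d = Finsupp.single i 1 := by
    intro d hd
    obtain ⟨i, -, hi⟩ := Finset.mem_biUnion.1 (support_sum hd)
    rw [C_mul_X_eq_monomial] at hi
    exact ⟨i, Finset.mem_singleton.1 (support_monomial_subset hi)⟩
  have hLeval : ∀ z, aeval z L = l z := by
    intro z
    have hz : z = ∑ j, z j • Pi.single j (1 : K) := by
      ext k
      simp [Finset.sum_apply, Pi.single_apply]
    conv_rhs => rw [hz, map_sum]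
    simp [L, mul_comm]
  have hLI : L ∈ I := by
    rw [← hrad.radical, ← vanishingIdeal_zeroLocus_eq_radical (K := K)]
    intro z hz
    rw [hLeval]
    exact hl (Submodule.subset_span hz)
  have hL0 : L ≠ 0 := by
    rintro h
    refine hl0 (LinearMap.ext fun z => ?_)
    rw [← hLeval, h, map_zero]
    rfl
  obtain ⟨i, hi⟩ := hLcoeff _ (m.degree_mem_support hL0)
  have hlt : m.leadingTerm L = C (m.leadingCoeff L) * X i := by
    rw [C_mul_X_eq_monomial, ← hi]
    rfl
  have hmem : C (m.leadingCoeff L) * X i ∈ initialIdeal m I := by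
    rw [← hlt]
    exact Ideal.subset_span ⟨L, hLI, rfl⟩
  have hItop : I ≠ ⊤ := by
    rintro rfl
    simp at hne
  refine C_mul_X_notMem_differentialPower (initialIdeal_ne_top m hItop)
    (m.leadingCoeff_ne_zero_iff.2 hL0) (i := i) ?_
  rw [← symbolicPower_eq_differentialPower hin]
  exact h2 (monomial_single_mem_secantIdeal_two hmem)

theorem le_symbolicPower_one {R : Type*} [CommRing R] (J : Ideal R) : J ≤ symbolicPower J 1 :=
  fun f hf => ⟨1, fun _ hP h => hP.1.1.ne_top ((Ideal.eq_top_iff_one _).2 h), by simpa using hf⟩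

/-- Secant ideals lie in symbolic powers of lower secant ideals. -/
theorem secantIdeal_le_symbolicPower (m : MonomialOrder σ) {I : Ideal (MvPolynomial σ K)}
    (hI : ∀ f ∈ I, ∀ d : ℕ, homogeneousComponent d f ∈ I)
    (hrad : I.IsRadical) (hin : (initialIdeal m I).IsRadical) {r s : ℕ} (hr : 1 ≤ r)
    (h2 : s ≠ 0 → secantIdeal (initialIdeal m I) 2 ≤ symbolicPower (initialIdeal m I) 2) :
    secantIdeal I (r + s) ≤ symbolicPower (secantIdeal I r) (s + 1) := by
  rcases eq_or_ne s 0 with rfl | hs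
  · exact le_symbolicPower_one _
  have := IsAlgClosed.instInfinite (K := K)
  rw [symbolicPower_eq_differentialPower (hrad.secantIdeal hr), hrad.secantIdeal_eq hr,
    hrad.secantIdeal_eq (by omega)]
  exact vanishingIdeal_iteratedSumset_le (fun c v hv => smul_mem_zeroLocus hI c hv)
    (span_zeroLocus_eq_top m hrad hin (h2 hs)) hr s

end Homogeneous

theorem symbolicPower_mul_le {R : Type*} [CommRing R] (J : Ideal R) (a b : ℕ) :
    symbolicPower J a * symbolicPower J b ≤ symbolicPower J (a + b) := by
  rw [Ideal.mul_le]
  rintro f ⟨c, hc, hcf⟩ g ⟨d, hd, hdg⟩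
  refine ⟨c * d, fun P hP h => (hP.1.1.mem_or_mem h).elim (hc P hP) (hd P hP), ?_⟩
  rw [mul_mul_mul_comm, pow_add]
  exact Ideal.mul_mem_mul hcf hdg

/-! ### Combinatorics of the products of Gröbner basis elements -/

section GroebnerProducts

variable {σ K : Type*} [Field K] {G : ℕ → Set (MvPolynomial σ K)} {r : ℕ}

theorem subset_groebnerProducts (G : ℕ → Set (MvPolynomial σ K)) (r s : ℕ) :
    G (r + s) ⊆ groebnerProducts G r (s + 1) := fun g hg =>
  ⟨1, fun _ => r + s, fun _ => g, fun _ => ⟨Nat.le_add_right r s, hg⟩, by simp, by simp⟩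

theorem mul_mem_groebnerProducts {i j : ℕ} {p q : MvPolynomial σ K}
    (hp : p ∈ groebnerProducts G r i) (hq : q ∈ groebnerProducts G r j) :
    p * q ∈ groebnerProducts G r (i + j) := by
  obtain ⟨l, ρ, g, hg, hs, rfl⟩ := hp
  obtain ⟨l', ρ', g', hg', hs', rfl⟩ := hq
  refine ⟨l + l', Fin.append ρ ρ', Fin.append g g', fun k => ?_, ?_, ?_⟩
  · induction k using Fin.addCases with
    | left k => simpa using hg k
    | right k => simpa using hg' k
  · simp [Fin.sum_univ_add, hs, hs']
  · simp [Fin.prod_univ_add]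

/-- Splitting off the first factor mirrors the shape of the recurrence: a lone factor matches the
secant ideal, a longer product a term of the sum. -/
theorem mem_groebnerProducts_succ {s : ℕ} {p : MvPolynomial σ K}
    (hp : p ∈ groebnerProducts G r (s + 1)) :
    p ∈ G (r + s) ∨ ∃ i ∈ Finset.Ico 1 (s + 1), ∃ g ∈ groebnerProducts G r i,
      ∃ q ∈ groebnerProducts G r (s + 1 - i), p = g * q := by
  obtain ⟨l, ρ, g, hg, hs, rfl⟩ := hp
  rcases l with - | l
  · simp at hs
  rw [Fin.sum_univ_succ] at hs
  rw [Fin.prod_univ_succ]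
  rcases l with - | l
  · left
    have h := hg 0
    have e : ρ 0 = r + s := by
      simp at hs
      omega
    simpa [e] using h.2
  · right
    have hpos : 1 ≤ ∑ i : Fin (l + 1), (ρ i.succ - r + 1) := by
      rw [Fin.sum_univ_succ]
      omega
    have hg0 : g 0 ∈ groebnerProducts G r (ρ 0 - r + 1) := by
      apply subset_groebnerProducts
      rw [Nat.add_sub_cancel' (hg 0).1]
      exact (hg 0).2
    refine ⟨ρ 0 - r + 1, Finset.mem_Ico.2 ⟨by omega, by omega⟩, g 0, hg0, _,
      ⟨l + 1, fun i => ρ i.succ, fun i => g i.succ, fun i => hg i.succ, by simp only; omega, rfl⟩, rfl⟩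

/-- Each factor has weight ρ - r + 1 ≥ 1, which bounds both the number of factors and the indices ρ.
-/
theorem finite_groebnerProducts {s : ℕ} (h : ∀ ρ, r ≤ ρ → ρ < r + s → (G ρ).Finite) :
    (groebnerProducts G r s).Finite := by
  have hU : (⋃ ρ ∈ Finset.Ico r (r + s), G ρ).Finite :=
    Set.Finite.biUnion (Finset.finite_toSet _) fun ρ hρ =>
      h ρ (Finset.mem_Ico.1 hρ).1 (Finset.mem_Ico.1 hρ).2
  refine Set.Finite.subset (Set.Finite.biUnion (Finset.finite_toSet (Finset.range (s + 1)))
    fun l _ => (Set.Finite.pi' fun _ : Fin l => hU).image fun g => ∏ i, g i) ?_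
  rintro _ ⟨l, ρ, g, hg, hs, rfl⟩
  have hl : l ≤ s := by
    rw [← hs]
    calc l = ∑ _i : Fin l, 1 := by simp
      _ ≤ _ := Finset.sum_le_sum fun i _ => by omega
  refine Set.mem_biUnion (Finset.mem_coe.2 (Finset.mem_range.2 (by omega))) ⟨g, fun i => ?_, rfl⟩
  have hi : ρ i - r + 1 ≤ s := by
    rw [← hs]
    exact Finset.single_le_sum (f := fun i => ρ i - r + 1) (fun _ _ => Nat.zero_le _)
      (Finset.mem_univ i)
  exact Set.mem_biUnion (Finset.mem_coe.2 (Finset.mem_Ico.2 ⟨(hg i).1, by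
    have := (hg i).1
    omega⟩)) (hg i).2

theorem groebnerProducts_subset_symbolicPower {J : Ideal (MvPolynomial σ K)} (s : ℕ)
    (h : ∀ s' ≤ s, G (r + s') ⊆ symbolicPower J (s' + 1)) :
    groebnerProducts G r (s + 1) ⊆ symbolicPower J (s + 1) := by
  induction s using Nat.strong_induction_on with
  | _ s ih =>
    intro p hp
    rcases mem_groebnerProducts_succ hp with hp | ⟨i, hi, g, hg, q, hq, rfl⟩
    · exact h s le_rfl hp
    · rw [Finset.mem_Ico] at hi
      obtain ⟨a, rfl⟩ := Nat.exists_eq_add_of_le' hi.1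
      obtain ⟨b, hb⟩ := Nat.exists_eq_add_of_le' (show 1 ≤ s + 1 - (a + 1) by omega)
      rw [hb] at hq
      have h1 := ih a (by omega) (fun s' hs' => h s' (by omega)) hg
      have h2 := ih b (by omega) (fun s' hs' => h s' (by omega)) hq
      have h3 := symbolicPower_mul_le J _ _ (Ideal.mul_mem_mul h1 h2)
      rwa [show a + 1 + (b + 1) = s + 1 by omega] at h3

end GroebnerProducts

/-! ### Transfer from the initial ideal to the ideal -/

section Recurrence

variable {σ K : Type*} [Field K]

theorem SatisfiesRecurrence.secantIdeal_two_le {M : Ideal (MvPolynomial σ K)}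
    (h : SatisfiesRecurrence M 1 2) : secantIdeal M 2 ≤ symbolicPower M 2 := by
  have h' : symbolicPower M 2 = secantIdeal M 2 + _ := h
  rw [h']
  exact le_sup_left

/-- If `M` satisfies the recurrence and `G ρ` has leading terms spanning the `ρ`-th secant ideal
of `M`, the leading terms of the products span the symbolic powers. -/
theorem symbolicPower_le_span_groebnerProducts (m : MonomialOrder σ)
    {M : Ideal (MvPolynomial σ K)} {G : ℕ → Set (MvPolynomial σ K)} {r : ℕ} (s : ℕ)
    (hrec : ∀ s' ≤ s, SatisfiesRecurrence M r (s' + 1))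
    (hG : ∀ s' ≤ s, secantIdeal M (r + s') ≤ Ideal.span (m.leadingTerm '' G (r + s'))) :
    symbolicPower (secantIdeal M r) (s + 1) ≤
      Ideal.span (m.leadingTerm '' groebnerProducts G r (s + 1)) := by
  induction s using Nat.strong_induction_on with
  | _ s ih =>
    rw [hrec s le_rfl, Ideal.add_eq_sup, Ideal.sum_eq_sup]
    refine sup_le ?_ (Finset.sup_le fun i hi => ?_)
    · exact (hG s le_rfl).trans (Ideal.span_mono (Set.image_mono (subset_groebnerProducts G r s)))
    · rw [Finset.mem_Ico] at hi
      obtain ⟨a, rfl⟩ := Nat.exists_eq_add_of_le' hi.1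
      obtain ⟨b, hb⟩ := Nat.exists_eq_add_of_le' (show 1 ≤ s + 1 - (a + 1) by omega)
      rw [hb]
      have h1 := ih a (by omega) (fun s' hs' => hrec s' (by omega)) fun s' hs' => hG s' (by omega)
      have h2 := ih b (by omega) (fun s' hs' => hrec s' (by omega)) fun s' hs' => hG s' (by omega)
      refine (Ideal.mul_mono h1 h2).trans ?_
      rw [Ideal.span_mul_span', Ideal.span_le]
      rintro _ ⟨_, ⟨p, hp, rfl⟩, _, ⟨q, hq, rfl⟩, rfl⟩
      -- Leading terms are multiplicative over a field, so products of generators are again leading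
      -- terms of products.
      refine Ideal.subset_span ⟨p * q, ?_, m.leadingTerm_mul p q⟩
      have := mul_mem_groebnerProducts hp hq
      rwa [show a + 1 + (b + 1) = s + 1 by omega] at this

variable [Finite σ] [IsAlgClosed K]

/-- With J = I^{r}, the chain in(J^(s+1)) ⊆ in(J)^(s+1) = (in(I)^{r})^(s+1) ends inside the ideal
generated by the leading terms of the products, which themselves lie in J^(s+1). -/
theorem isGroebnerBasis_groebnerProducts (m : MonomialOrder σ) {I : Ideal (MvPolynomial σ K)}
    (hI : ∀ f ∈ I, ∀ d : ℕ, homogeneousComponent d f ∈ I)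
    (hrad : I.IsRadical) (hinrad : (initialIdeal m I).IsRadical) {r s : ℕ} (hr : 1 ≤ r)
    (hdel : ∀ s' ≤ s, IsDelightfulAt m I (r + s'))
    (hrec : ∀ s' ≤ s, SatisfiesRecurrence (initialIdeal m I) r (s' + 1))
    (h2 : s ≠ 0 → SatisfiesRecurrence (initialIdeal m I) 1 2)
    {G : ℕ → Set (MvPolynomial σ K)}
    (hG : ∀ s' ≤ s, IsGroebnerBasis m (G (r + s')) (secantIdeal I (r + s'))) :
    IsGroebnerBasis m (groebnerProducts G r (s + 1)) (symbolicPower (secantIdeal I r) (s + 1)) := by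
  have hsub : groebnerProducts G r (s + 1) ⊆ symbolicPower (secantIdeal I r) (s + 1) :=
    groebnerProducts_subset_symbolicPower s fun s' hs' => (hG s' hs').1.trans
      (secantIdeal_le_symbolicPower m hI hrad hinrad hr
        fun h => (h2 (by omega)).secantIdeal_two_le)
  refine ⟨hsub, le_antisymm (Ideal.span_mono (Set.image_mono hsub)) ?_⟩
  have hr0 : initialIdeal m (secantIdeal I r) = secantIdeal (initialIdeal m I) r :=
    hdel 0 (Nat.zero_le s)
  refine (initialIdeal_symbolicPower_le m (hrad.secantIdeal hr) ?_ (s + 1)).trans ?_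
  · rw [hr0]
    exact hinrad.secantIdeal hr
  · rw [hr0]
    refine symbolicPower_le_span_groebnerProducts m s hrec fun s' hs' => ?_
    rw [(hG s' hs').2]
    exact (hdel s' hs').ge

/-- With each `G ρ` the whole secant ideal, every product lies in the right side of the recurrence,
which therefore has at least the initial ideal of the symbolic power containing it. -/
theorem satisfiesRecurrence_of_initialIdeal (m : MonomialOrder σ) {I : Ideal (MvPolynomial σ K)}
    (hI : ∀ f ∈ I, ∀ d : ℕ, homogeneousComponent d f ∈ I)
    (hrad : I.IsRadical) (hinrad : (initialIdeal m I).IsRadical) {r s : ℕ} (hr : 1 ≤ r)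
    (hdel : ∀ s' ≤ s, IsDelightfulAt m I (r + s'))
    (hrec : ∀ s' ≤ s, SatisfiesRecurrence (initialIdeal m I) r (s' + 1))
    (h2 : s ≠ 0 → SatisfiesRecurrence (initialIdeal m I) 1 2) :
    SatisfiesRecurrence I r (s + 1) := by
  let G : ℕ → Set (MvPolynomial σ K) := fun ρ => secantIdeal I ρ
  have hgb : ∀ s' ≤ s, IsGroebnerBasis m (groebnerProducts G r (s' + 1))
      (symbolicPower (secantIdeal I r) (s' + 1)) := fun s' hs' =>
    isGroebnerBasis_groebnerProducts m hI hrad hinrad hr (fun k hk => hdel k (hk.trans hs'))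
      (fun k hk => hrec k (hk.trans hs')) (fun h => h2 (by omega)) fun _ _ => ⟨subset_rfl, rfl⟩
  rw [SatisfiesRecurrence, Ideal.add_eq_sup, Ideal.sum_eq_sup]
  symm
  refine eq_of_initialIdeal_le m (sup_le ?_ (Finset.sup_le fun i hi => ?_)) ?_
  · exact secantIdeal_le_symbolicPower m hI hrad hinrad hr fun h => (h2 h).secantIdeal_two_le
  · rw [Finset.mem_Ico] at hi
    refine (symbolicPower_mul_le _ _ _).trans_eq ?_
    rw [Nat.add_sub_cancel' (by omega)]
  · rw [← (hgb s le_rfl).2]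
    refine Ideal.span_mono (Set.image_mono fun p hp => ?_)
    rcases mem_groebnerProducts_succ hp with hp | ⟨i, hi, g, hg, q, hq, rfl⟩
    · exact Ideal.mem_sup_left hp
    · refine Ideal.mem_sup_right ?_
      refine Finset.le_sup (f := fun i => symbolicPower (secantIdeal I r) i *
        symbolicPower (secantIdeal I r) (s + 1 - i)) hi ?_
      rw [Finset.mem_Ico] at hi
      obtain ⟨a, rfl⟩ := Nat.exists_eq_add_of_le' hi.1
      obtain ⟨b, hb⟩ := Nat.exists_eq_add_of_le' (show 1 ≤ s + 1 - (a + 1) by omega)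
      rw [hb] at hq ⊢
      exact Ideal.mul_mem_mul ((hgb a (by omega)).1 hg) ((hgb b (by omega)).1 hq)

end Recurrence

theorem mainTheorem5 {σ : Type*} [Finite σ] {K : Type*} [Field K] [IsAlgClosed K]
    (m : MonomialOrder σ) (I : Ideal (MvPolynomial σ K))
    (hI : ∀ f ∈ I, ∀ d : ℕ, MvPolynomial.homogeneousComponent d f ∈ I)
    (hrad : I.IsRadical) (hinrad : (initialIdeal m I).IsRadical) :
    (∀ t u : ℕ,
      (∀ r, 1 ≤ r → r ≤ t → IsDelightfulAt m I r) →
      (∀ r s, 1 ≤ r → r ≤ t → 1 ≤ s → s ≤ u → SatisfiesRecurrence (initialIdeal m I) r s) →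
      (∀ G : ℕ → Set (MvPolynomial σ K),
        (∀ r, 1 ≤ r → r ≤ t → IsGroebnerBasis m (G r) (secantIdeal I r)) →
        ∀ r s, 1 ≤ r → r ≤ t → 1 ≤ s → s ≤ min u (t - r + 1) →
          IsGroebnerBasis m (groebnerProducts G r s) (symbolicPower (secantIdeal I r) s) ∧
          ((∀ r', 1 ≤ r' → r' ≤ t → (G r').Finite) → (groebnerProducts G r s).Finite)) ∧
      (∀ r s, 1 ≤ r → r ≤ t → 1 ≤ s → s ≤ min u (t - r + 1) → SatisfiesRecurrence I r s)) ∧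
    (IsDelightful m I → IsDiffPerfect (initialIdeal m I) → IsDiffPerfect I) := by
  refine ⟨fun t u hdel hrec => ⟨fun G hG r s hr hrt hs hsu => ⟨?_, fun hfin => ?_⟩,
    fun r s hr hrt hs hsu => ?_⟩, fun hdel hperf r hr s hs => ?_⟩
  · obtain ⟨s, rfl⟩ := Nat.exists_eq_add_of_le' hs
    rw [le_min_iff] at hsu
    exact isGroebnerBasis_groebnerProducts m hI hrad hinrad hr
      (fun k hk => hdel _ (by omega) (by omega))
      (fun k hk => hrec _ _ hr hrt (by omega) (by omega))
      -- After the shift, `s ≠ 0` means order at least 2, which forces `u ≥ 2` and puts (1, 2) in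
      -- range.
      (fun h => hrec 1 2 le_rfl (by omega) (by omega) (by omega))
      fun k hk => hG _ (by omega) (by omega)
  · rw [le_min_iff] at hsu
    exact finite_groebnerProducts fun ρ h1 h2 => hfin ρ (by omega) (by omega)
  · obtain ⟨s, rfl⟩ := Nat.exists_eq_add_of_le' hs
    rw [le_min_iff] at hsu
    exact satisfiesRecurrence_of_initialIdeal m hI hrad hinrad hr
      (fun k hk => hdel _ (by omega) (by omega))
      (fun k hk => hrec _ _ hr hrt (by omega) (by omega))
      fun h => hrec 1 2 le_rfl (by omega) (by omega) (by omega)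
  · obtain ⟨s, rfl⟩ := Nat.exists_eq_add_of_le' hs
    exact satisfiesRecurrence_of_initialIdeal m hI hrad hinrad hr
      (fun k _ => hdel _ (by omega)) (fun k _ => hperf r hr _ (by omega))
      fun _ => hperf 1 le_rfl 2 (by omega)
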